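/- All graphs are finite, simple and undirected. Write $P_r$ for the path on $r$ vertices, $G_1+G_2$ for the disjoint union of two graphs, and $sP_1+P_4$ for the disjoint union of $s$ isolated vertices and $P_4$. A graph is $H$-free if it has no induced subgraph isomorphic to $H$. A vertex set $S$ of a graph $G$ is connected if it is non-empty and $G[S]$ is connected. For a fixed integer $k$, the decision problem $k$-Disjoint Connected Subgraphs takes as input a graph $G$ and pairwise disjoint sets $Z_1,\dots,Z_k\subseteq V(G)$, and asks whether $G$ has pairwise disjoint connected sets $S_1,\dots,S_k$ with $Z_i\subseteq S_i$ for every $i\in\{1,\dots,k\}$. Lemma. Let $H$ be a graph that is isomorphic to an induced subgraph of $sP_1+P_4$ for some integer $s\ge 0$. Then, for every fixed $k\ge 1$, $k$-Disjoint Connected Subgraphs restricted to $H$-free graphs $G$ is solvable in polynomial time (on a Turing machine, with $G$ given by its adjacency matrix and each $Z_i$ by its characteristic vector). -/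

import Mathlib

namespace DisjointConnectedSubgraphs

/-- The graph `sP₁ + P₄`: the disjoint union of `s` isolated vertices and a path on four
vertices. -/
def sP1P4 (s : ℕ) : SimpleGraph (Fin s ⊕ Fin 4) :=
  SimpleGraph.sum (⊥ : SimpleGraph (Fin s)) (SimpleGraph.pathGraph 4)

/-- `G` is `H`-free: it has no induced subgraph isomorphic to `H`. -/
def IsFree {V W : Type*} (H : SimpleGraph W) (G : SimpleGraph V) : Prop :=
  ¬ H.IsIndContained G

/-- An instance of `k`-Disjoint Connected Subgraphs: a finite graph, on the vertex set
`{0, …, n - 1}`, and `k` pairwise disjoint sets of terminals. -/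
structure Instance (k : ℕ) where
  /-- the number of vertices -/
  n : ℕ
  /-- the graph -/
  graph : SimpleGraph (Fin n)
  /-- the terminal sets -/
  terminals : Fin k → Finset (Fin n)
  /-- the terminal sets are pairwise disjoint -/
  disjoint_terminals : ∀ i j, i ≠ j → Disjoint (terminals i) (terminals j)

/-- A solution: pairwise disjoint sets `S i`, each inducing a connected subgraph and
containing the corresponding terminal set. -/
def Instance.IsSolution {k : ℕ} (I : Instance k) (S : Fin k → Finset (Fin I.n)) : Prop :=
  (∀ i j, i ≠ j → Disjoint (S i) (S j)) ∧
    ∀ i, I.terminals i ⊆ S i ∧ (I.graph.induce (S i : Set (Fin I.n))).Connected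

/-- The question of `k`-Disjoint Connected Subgraphs: is there a solution? -/
def Instance.IsYes {k : ℕ} (I : Instance k) : Prop :=
  ∃ S : Fin k → Finset (Fin I.n), I.IsSolution S

open Classical in
/-- The input string of an instance: the number `n` of vertices in unary, ended by a `false`;
then the adjacency matrix, row by row; then the characteristic vectors of the `k` terminal
sets. It has length `n + 1 + n ^ 2 + k * n`. -/
noncomputable def Instance.encode {k : ℕ} (I : Instance k) : List Bool :=
  List.replicate I.n true ++ [false] ++
    ((List.finRange I.n).flatMap fun u =>
      (List.finRange I.n).map fun v => decide (I.graph.Adj u v)) ++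
    ((List.finRange k).flatMap fun i =>
      (List.finRange I.n).map fun v => decide (v ∈ I.terminals i))

open Classical in
/-- The decision problem `P`, restricted to the inputs in the class `C` and with inputs written
as strings by `enc`, is solvable in polynomial time: there are a (multi-stack) Turing machine and
a polynomial `p` such that on the string of every `x` in `C`, of length `ℓ`, the machine halts
within `p ℓ` steps with the truth value of `P x` as its output. Nothing is required of the
machine on other strings. -/
def PolyTimeSolvableOn {α : Type} (enc : α → List Bool) (C : Set α) (P : α → Prop) : Prop :=
  Nonempty (Turing.TM2ComputableInPolyTime
    (fun x : C => enc x) (fun b : Bool => [b]) (fun x : C => decide (P x)))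

end DisjointConnectedSubgraphs

/-! A connected `sP₁ + P₄`-free graph has a dominating set of at most `s + 4` vertices: without an
induced `P₄`, at most two vertices suffice; otherwise take an induced `s'P₁ + P₄` with `s'` maximal,
since an undominated vertex would be one more isolated vertex (`exists_dominates_of_free`). A
dominating set of `m` vertices bounds all distances by `3m`, so a walk of constant length `c =
walkLength s` visits it.

An `H`-free graph is `sP₁ + P₄`-free, and so are the connected graphs `G[Sᵢ]` of a solution. Each
`Sᵢ` may thus be shrunk to `Zᵢ` and a walk of `c + 1` vertices dominating `Zᵢ`; conversely such
walks give a solution (`Instance.isYes_iff_exists_isCertificate`). As `k` and `s` are fixed, only `n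
^ (k(c + 1))` candidates remain.

An explicit machine tries them all. A candidate places `N = k(c + 1)` marks on the vertices; read as
an `N`-digit number in base `n`, it is counted down from the largest value (`runsIn_search`). The
conditions on a candidate are local to a vertex and its neighbours, so the finite control checks
them in one pass over the adjacency matrix. -/

namespace DisjointConnectedSubgraphs

open SimpleGraph

/-! ### Small dominating sets and short dominating walks -/

section Graph

variable {V : Type*} {G : SimpleGraph V}

/-- `Q` is a dominating set of `G`: every vertex is in `Q` or has a neighbour in `Q`. -/
def Dominates (G : SimpleGraph V) (Q : Finset V) : Prop :=
  ∀ v, ∃ q ∈ Q, v = q ∨ G.Adj v q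

theorem sP1P4_adj_iff {s : ℕ} {x y : Fin s ⊕ Fin 4} : (sP1P4 s).Adj x y ↔
    ∃ i j, x = Sum.inr i ∧ y = Sum.inr j ∧ (pathGraph 4).Adj i j := by
  rcases x with x | x <;> rcases y with y | y <;> simp [sP1P4, sum_adj]

/-- The adjacencies and non-adjacencies already force the four vertices to be distinct. -/
theorem sP1P4_zero_isIndContained {a b c d : V} (hab : G.Adj a b) (hbc : G.Adj b c)
    (hcd : G.Adj c d) (hac : ¬ G.Adj a c) (hbd : ¬ G.Adj b d) (had : ¬ G.Adj a d) :
    (sP1P4 0).IsIndContained G := by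
  have hca : a ≠ c := by rintro rfl; exact had hcd
  have hda : a ≠ d := by rintro rfl; exact hbd hab.symm
  have hdb : b ≠ d := by rintro rfl; exact had hab
  refine ⟨⟨⟨Sum.elim Fin.elim0 ![a, b, c, d], ?_⟩, ?_⟩⟩
  · rintro (x | x) (y | y) h
    · exact x.elim0
    · exact x.elim0
    · exact y.elim0
    · congr 1
      have := hab.ne; have := hbc.ne; have := hcd.ne
      fin_cases x <;> fin_cases y <;> simp_all
  · rintro (x | x) (y | y)
    · exact x.elim0
    · exact x.elim0
    · exact y.elim0
    · have h1 := hab.symm; have h2 := hbc.symm; have h3 := hcd.symm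
      have h4 : ¬ G.Adj c a := fun h => hac h.symm
      have h5 : ¬ G.Adj d b := fun h => hbd h.symm
      have h6 : ¬ G.Adj d a := fun h => had h.symm
      change G.Adj (![a, b, c, d] x) (![a, b, c, d] y) ↔ _
      rw [sP1P4_adj_iff]
      fin_cases x <;> fin_cases y <;> simp_all [pathGraph_adj]

/-- Induction along a walk ending in `v`: a vertex `a` at distance three, reached through `u` and
`b`, would make `v, u, b, a` an induced `P₄`. -/
theorem dist_le_two_of_free (hG : G.Connected) (hf : IsFree (sP1P4 0) G) (v z : V) :
    z = v ∨ G.Adj v z ∨ ∃ u, G.Adj v u ∧ G.Adj u z := by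
  obtain ⟨p⟩ := hG.preconnected z v
  induction p with
  | nil => exact Or.inl rfl
  | @cons a b v hab p ih =>
    rcases ih with rfl | h | ⟨u, hu, hub⟩
    · exact Or.inr (Or.inl hab.symm)
    · exact Or.inr (Or.inr ⟨b, h, hab.symm⟩)
    · by_contra! hc
      obtain ⟨-, hva, hc⟩ := hc
      by_cases hvb : G.Adj v b
      · exact hc b hvb hab.symm
      · exact hf (sP1P4_zero_isIndContained hu hub hab.symm hvb (hc u hu) hva)

/-- Fix `v` and choose its neighbour `w` covering the most vertices at distance two from `v`. If `z`
is missed by `{v, w}`, reach it through a neighbour `u` of `v`. By `P₄`-freeness, `u` covers all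
that `w` covers, and also `z`, against the choice of `w`. -/
theorem exists_dominates_of_free_zero [Finite V] (hG : G.Connected)
    (hf : IsFree (sP1P4 0) G) : ∃ Q : Finset V, Q.card ≤ 4 ∧ Dominates G Q := by
  classical
  have := Fintype.ofFinite V
  obtain ⟨v⟩ := hG.nonempty
  have key := dist_le_two_of_free hG hf v
  by_cases hne : (G.neighborFinset v).Nonempty
  · obtain ⟨w, hw, hmax⟩ := Finset.exists_max_image _
      (fun w => ((Finset.univ.filter fun y => G.Adj w y ∧ ¬ G.Adj v y ∧ y ≠ v)).card) hne
    rw [mem_neighborFinset] at hw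
    refine ⟨{v, w}, Finset.card_le_two.trans (by norm_num), fun z => ?_⟩
    by_contra! hc
    simp only [Finset.mem_insert, Finset.mem_singleton, forall_eq_or_imp, forall_eq] at hc
    obtain ⟨⟨hzv, hzv'⟩, hzw, hzw'⟩ := hc
    rcases key z with h | h | ⟨u, hvu, huz⟩
    · exact hzv h
    · exact hzv' h.symm
    have hvz : ¬ G.Adj v z := fun h => hzv' h.symm
    -- Otherwise `z, u, v, w` is an induced `P₄`.
    have huw : G.Adj u w := by
      by_contra h
      exact hf (sP1P4_zero_isIndContained huz.symm hvu.symm hw hzv' h hzw')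
    have hlt := hmax u (by simpa using hvu)
    refine hlt.not_gt (Finset.card_lt_card ?_)
    rw [Finset.ssubset_iff_of_subset]
    · exact ⟨z, by simp [huz, hvz, hzv], by simp [show ¬ G.Adj w z from fun h => hzw' h.symm]⟩
    · intro y hy
      simp only [Finset.mem_filter, Finset.mem_univ, true_and] at hy ⊢
      refine ⟨?_, hy.2⟩
      by_contra huy
      -- The induced `P₄` is `v, w, y, z` or `y, w, u, z`.
      by_cases hyz : G.Adj y z
      · exact hf (sP1P4_zero_isIndContained hw hy.1 hyz hy.2.1 (fun h => hzw' h.symm) hvz)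
      · exact hf (sP1P4_zero_isIndContained hy.1.symm huw.symm huz (fun h => huy h.symm)
          (fun h => hzw' h.symm) hyz)
  · refine ⟨{v}, by simp, fun z => ⟨v, by simp, ?_⟩⟩
    have hno : ∀ u, ¬ G.Adj v u := fun u hu => hne ⟨u, by simpa using hu⟩
    rcases key z with h | h | ⟨u, hvu, -⟩
    · exact Or.inl h
    · exact absurd h (hno _)
    · exact absurd hvu (hno _)

theorem sP1P4_succ_isIndContained {s : ℕ} (f : sP1P4 s ↪g G) {v : V}
    (hv : ∀ x, v ≠ f x ∧ ¬ G.Adj v (f x)) : (sP1P4 (s + 1)).IsIndContained G := by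
  have hv' : ∀ x, ¬ G.Adj (f x) v := fun x h => (hv x).2 h.symm
  refine ⟨⟨⟨Sum.elim (Fin.cons v fun i => f (Sum.inl i)) fun j => f (Sum.inr j), ?_⟩, ?_⟩⟩
  · rintro (x | x) (y | y) h
    · refine Fin.cases ?_ (fun x => ?_) x h <;> refine Fin.cases ?_ (fun y => ?_) y <;> intro h
      · rfl
      · exact absurd h (by simpa using (hv (Sum.inl y)).1)
      · exact absurd h (by simpa using (hv (Sum.inl x)).1.symm)
      · simpa using h
    · refine Fin.cases ?_ (fun x => ?_) x h <;> intro h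
      · exact absurd h (by simpa using (hv (Sum.inr y)).1)
      · simp at h
    · refine Fin.cases ?_ (fun x => ?_) y h <;> intro h
      · exact absurd h (by simpa using (hv (Sum.inr x)).1.symm)
      · simp at h
    · simpa using h
  · rintro (x | x) (y | y)
    · change G.Adj (Fin.cons (α := fun _ => V) v (fun i => f (Sum.inl i)) x)
        (Fin.cons (α := fun _ => V) v (fun i => f (Sum.inl i)) y) ↔ _
      refine Fin.cases ?_ (fun x => ?_) x <;> refine Fin.cases ?_ (fun y => ?_) y <;>
        simp [sP1P4_adj_iff, (hv _).2, hv', f.map_adj_iff]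
    · change G.Adj (Fin.cons (α := fun _ => V) v (fun i => f (Sum.inl i)) x) (f (Sum.inr y)) ↔ _
      refine Fin.cases ?_ (fun x => ?_) x <;> simp [sP1P4_adj_iff, (hv _).2, f.map_adj_iff]
    · change G.Adj (f (Sum.inr x)) (Fin.cons (α := fun _ => V) v (fun i => f (Sum.inl i)) y) ↔ _
      refine Fin.cases ?_ (fun y => ?_) y <;> simp [sP1P4_adj_iff, hv', f.map_adj_iff]
    · change G.Adj (f (Sum.inr x)) (f (Sum.inr y)) ↔ _
      simp [sP1P4_adj_iff, f.map_adj_iff]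

/-- Either the smaller forbidden graph is absent too and induction applies, or the `s + 4` vertices
of a copy of it dominate: a missed vertex would extend the copy. -/
theorem exists_dominates_of_free [Finite V] (hG : G.Connected) (s : ℕ)
    (hf : IsFree (sP1P4 s) G) : ∃ Q : Finset V, Q.card ≤ s + 4 ∧ Dominates G Q := by
  classical
  induction s with
  | zero => simpa using exists_dominates_of_free_zero hG hf
  | succ s ih =>
    by_cases h : IsFree (sP1P4 s) G
    · obtain ⟨Q, hQ, hd⟩ := ih h
      exact ⟨Q, by omega, hd⟩
    · obtain ⟨f⟩ := not_not.1 h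
      refine ⟨Finset.univ.image f, Finset.card_image_le.trans (by simp), fun v => ?_⟩
      by_contra! hc
      exact hf (sP1P4_succ_isIndContained f fun x => hc _ (by simp))

/-- On a geodesic longer than `3 * m`, the vertices at positions `0, 3, …, 3m` outnumber `Q`, so two
share a dominator. They are at distance at most two, yet at least three apart on the geodesic. -/
theorem dist_le_of_dominates (hG : G.Connected) {Q : Finset V} {m : ℕ} (hQ : Q.card ≤ m)
    (hd : Dominates G Q) (u v : V) : G.dist u v ≤ 3 * m := by
  by_contra! hlt
  obtain ⟨p, hp⟩ := hG.exists_walk_length_eq_dist u v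
  choose q hqQ hq using fun i : ℕ => hd (p.getVert (3 * i))
  obtain ⟨i, hi, j, hj, hij, he⟩ := Finset.exists_ne_map_eq_of_card_lt_of_maps_to
    (s := Finset.range (m + 1)) (t := Q) (by simp; omega) (f := q) (fun i _ => hqQ i)
  wlog hlt' : i < j generalizing i j
  · exact this j hj i hi hij.symm he.symm (by omega)
  have hle : ∀ i, G.dist (p.getVert (3 * i)) (q i) ≤ 1 := fun i => by
    rcases hq i with h | h
    · rw [h]; simp
    · exact (dist_le h.toWalk).trans (by simp)
  have h1 := dist_le (p.take (3 * i))
  have h2 := dist_le (p.drop (3 * j))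
  rw [Walk.take_length] at h1
  rw [Walk.drop_length] at h2
  have h3 := hG.dist_triangle (u := u) (v := p.getVert (3 * i)) (w := v)
  have h4 := hG.dist_triangle (u := p.getVert (3 * i)) (v := q i) (w := v)
  have h5 := hG.dist_triangle (u := q i) (v := p.getVert (3 * j)) (w := v)
  have h6 := hle i
  have h7 := hle j
  rw [dist_comm, ← he] at h7
  simp only [Finset.mem_range] at hi hj
  omega

/-- A sequence of vertices in which each one is equal or adjacent to its predecessor. -/
def IsLazyWalk (G : SimpleGraph V) (y : ℕ → V) : Prop :=
  ∀ t, y t = y (t + 1) ∨ G.Adj (y t) (y (t + 1))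

/-- Geodesics are concatenated, with `D` time units allotted to each. Laziness absorbs the unused
time: `getVert` stays at the endpoint beyond the length of a walk. -/
theorem exists_isLazyWalk_visiting (hG : G.Connected) {D : ℕ} (hD : ∀ u v, G.dist u v ≤ D)
    (L : List V) : ∃ y : ℕ → V, IsLazyWalk G y ∧ ∀ q ∈ L, ∃ t ≤ L.length * D, y t = q := by
  induction L with
  | nil =>
    obtain ⟨v⟩ := hG.nonempty
    exact ⟨fun _ => v, fun _ => Or.inl rfl, by simp⟩
  | cons a L ih =>
    obtain ⟨y, hy, hL⟩ := ih
    obtain ⟨p, hp⟩ := hG.exists_walk_length_eq_dist (y (L.length * D)) a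
    have hpD : p.length ≤ D := hp ▸ hD _ _
    refine ⟨fun t => if t ≤ L.length * D then y t else p.getVert (t - L.length * D),
      fun t => ?_, ?_⟩
    · rcases lt_or_ge t (L.length * D) with h | h
      · simpa [h.le, Nat.succ_le_of_lt h] using hy t
      · obtain ⟨r, rfl⟩ := Nat.exists_eq_add_of_le h
        -- At the junction `r = 0` both branches agree, because `p` starts where `y` has arrived.
        have h0 : (if L.length * D + r ≤ L.length * D then y (L.length * D + r)
            else p.getVert (L.length * D + r - L.length * D)) = p.getVert r := by
          rcases Nat.eq_zero_or_pos r with rfl | hr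
          · simp
          · simp [hr.ne']
        have h1 : ¬ L.length * D + r + 1 ≤ L.length * D := by omega
        have h2 : L.length * D + r + 1 - L.length * D = r + 1 := by omega
        simp only [h0, h1, if_false, h2]
        rcases lt_or_ge r p.length with hr | hr
        · exact Or.inr (p.adj_getVert_succ hr)
        · left
          rw [p.getVert_of_length_le hr, p.getVert_of_length_le (by omega)]
    · intro q hq
      rcases List.mem_cons.1 hq with rfl | hq
      · refine ⟨(L.length + 1) * D, le_rfl, ?_⟩
        rw [add_mul, one_mul]
        dsimp only
        split_ifs with h
        · have : D = 0 := by omega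
          subst this
          have : p.length = 0 := by omega
          simpa using Walk.eq_of_length_eq_zero this
        · rw [Nat.add_sub_cancel_left, p.getVert_of_length_le hpD]
      · obtain ⟨t, ht, rfl⟩ := hL q hq
        refine ⟨t, ht.trans (by rw [List.length_cons]; gcongr; omega), by simp [ht]⟩

/-- The length of a dominating lazy walk that suffices in connected `sP₁ + P₄`-free graphs. -/
def walkLength (s : ℕ) : ℕ := (s + 4) * (3 * (s + 4))

/-- `walkLength` is the number `s + 4` of vertices to visit times the distance bound `3 * (s + 4)`.
-/
theorem exists_isLazyWalk_dominating [Finite V] (hG : G.Connected) (s : ℕ)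
    (hf : IsFree (sP1P4 s) G) : ∃ y : ℕ → V, IsLazyWalk G y ∧
      ∀ v, ∃ t ≤ walkLength s, v = y t ∨ G.Adj v (y t) := by
  obtain ⟨Q, hQ, hd⟩ := exists_dominates_of_free hG s hf
  obtain ⟨y, hy, hL⟩ := exists_isLazyWalk_visiting hG (dist_le_of_dominates hG hQ hd) Q.toList
  refine ⟨y, hy, fun v => ?_⟩
  obtain ⟨q, hq, hv⟩ := hd v
  obtain ⟨t, ht, rfl⟩ := hL q (by simpa using hq)
  refine ⟨t, ht.trans ?_, hv⟩
  rw [Finset.length_toList]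
  exact Nat.mul_le_mul_right _ hQ

end Graph

/-! ### Certificates of constant size -/

/-- A bounded certificate for an instance: `k` lazy walks of `c + 1` vertices each, the `i`-th of
which dominates the `i`-th terminal set, such that the unions of walks and terminal sets are
pairwise disjoint. -/
structure Instance.IsCertificate {k : ℕ} (I : Instance k) (c : ℕ)
    (x : Fin k → ℕ → Fin I.n) : Prop where
  step : ∀ i, ∀ t < c, x i t = x i (t + 1) ∨ I.graph.Adj (x i t) (x i (t + 1))
  dom : ∀ i, ∀ z ∈ I.terminals i, ∃ t ≤ c, z = x i t ∨ I.graph.Adj z (x i t)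
  avoid : ∀ i, ∀ t ≤ c, ∀ j, i ≠ j → x i t ∉ I.terminals j
  disj : ∀ i, ∀ t ≤ c, ∀ j, i ≠ j → ∀ t' ≤ c, x i t ≠ x j t'

/-- The solution sets are the terminals together with the walk: the walk is connected, and each
terminal lies on it or is attached to it. -/
theorem Instance.IsCertificate.isYes {k : ℕ} {I : Instance k} {c : ℕ}
    {x : Fin k → ℕ → Fin I.n} (h : I.IsCertificate c x) : I.IsYes := by
  classical
  refine ⟨fun i => I.terminals i ∪ (Finset.range (c + 1)).image (x i), ?_, ?_⟩
  · intro i j hij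
    have hd := Finset.disjoint_left.1 (I.disjoint_terminals i j hij)
    rw [Finset.disjoint_left]
    intro a ha hb
    simp only [Finset.mem_union, Finset.mem_image, Finset.mem_range, Nat.lt_succ_iff] at ha hb
    rcases ha with ha | ⟨t, ht, rfl⟩ <;> rcases hb with hb | ⟨t', ht', hb⟩
    · exact hd ha hb
    · exact h.avoid j t' ht' i hij.symm (hb ▸ ha)
    · exact h.avoid i t ht j hij hb
    · exact h.disj i t ht j hij t' ht' hb.symm
  · intro i
    refine ⟨Finset.subset_union_left, ?_⟩
    set S := I.terminals i ∪ (Finset.range (c + 1)).image (x i) with hS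
    have hx : ∀ t ≤ c, x i t ∈ (S : Set (Fin I.n)) := fun t ht => by
      simp only [hS, Finset.coe_union, Finset.coe_image]
      exact Or.inr ⟨t, by simpa using Nat.lt_succ_of_le ht, rfl⟩
    rw [connected_iff_exists_forall_reachable]
    refine ⟨⟨x i 0, hx 0 (Nat.zero_le _)⟩, ?_⟩
    have hreach : ∀ t (ht : t ≤ c), (I.graph.induce (S : Set (Fin I.n))).Reachable
        ⟨x i 0, hx 0 (Nat.zero_le _)⟩ ⟨x i t, hx t ht⟩ := by
      intro t
      induction t with
      | zero => intro _; exact Reachable.refl _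
      | succ t ih =>
        intro ht
        refine (ih (by omega)).trans ?_
        rcases h.step i t (by omega) with he | ha
        · simp only [he]; exact Reachable.refl _
        · exact Adj.reachable (by simpa using ha)
    rintro ⟨w, hw⟩
    have hw' := hw
    simp only [Finset.coe_union, Finset.coe_image, Set.mem_union, Finset.mem_coe] at hw'
    rcases hw' with hw' | ⟨t, ht, rfl⟩
    · obtain ⟨t, ht, rfl | ha⟩ := h.dom i w hw'
      · exact hreach t ht
      · exact (hreach t ht).trans (Adj.reachable (by simpa using ha.symm))
    · exact hreach t (by simpa [Nat.lt_succ_iff] using ht)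

theorem Instance.isYes_iff_exists_isCertificate {k : ℕ} (I : Instance k) {s : ℕ}
    (hf : IsFree (sP1P4 s) I.graph) :
    I.IsYes ↔ ∃ x : Fin k → ℕ → Fin I.n, I.IsCertificate (walkLength s) x := by
  constructor
  · rintro ⟨S, hdisj, hS⟩
    have hw : ∀ i, ∃ y : ℕ → (S i : Set (Fin I.n)),
        IsLazyWalk (I.graph.induce (S i : Set (Fin I.n))) y ∧
        ∀ v, ∃ t ≤ walkLength s, v = y t ∨ (I.graph.induce (S i : Set (Fin I.n))).Adj v (y t) :=
      -- Freeness passes to `G[Sᵢ]` because an induced subgraph of an induced subgraph is induced.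
      fun i => exists_isLazyWalk_dominating (hS i).2 s
        fun h => hf (h.trans ⟨Embedding.induce _⟩)
    choose y hy hdom using hw
    have hne : ∀ i j, i ≠ j → ∀ t, (y i t : Fin I.n) ∉ S j := fun i j hij t h =>
      Finset.disjoint_left.1 (hdisj i j hij) (y i t).2 h
    refine ⟨fun i t => y i t, fun i t _ => ?_, fun i z hz => ?_, fun i t _ j hij h => ?_,
      fun i t _ j hij t' _ h => ?_⟩
    · exact (hy i t).imp (fun h => congrArg _ h) (fun h => by simpa using h)
    · obtain ⟨t, ht, h⟩ := hdom i ⟨z, (hS i).1 hz⟩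
      exact ⟨t, ht, h.imp (fun h => congrArg Subtype.val h) (fun h => by simpa using h)⟩
    · exact hne i j hij t ((hS j).1 h)
    · exact hne i j hij t (h ▸ (y j t').2)
  · rintro ⟨x, hx⟩
    exact hx.isYes

end DisjointConnectedSubgraphs
-- The marking machine
namespace DisjointConnectedSubgraphs

namespace MarkingMachine

open Turing Turing.TM2.Stmt

/-- A cell of a vertex tape: the marks placed on a vertex and the sets that contain it. -/
abbrev Cell (N k : ℕ) : Type := (Fin N → Bool) × (Fin k → Bool)

/-- The empty cell. -/
def Cell.blank (N k : ℕ) : Cell N k := (fun _ => false, fun _ => false)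

/-- The stacks: `inp` for input and output, and two stacks (the parts in front of and behind the
head) for each of the matrix tape `a`, `b`, the row tape `t`, `u` and the column tape `c`, `d`. -/
inductive StackName
  | inp | a | b | t | u | c | d
  deriving DecidableEq

instance : Fintype StackName := ⟨{.inp, .a, .b, .t, .u, .c, .d}, fun x => by cases x <;> simp⟩

/-- The stack alphabets. -/
abbrev Alphabet (N k : ℕ) : StackName → Type
  | .inp | .a | .b => Bool
  | .t | .u | .c | .d => Cell N k

/-- The labels of the program. -/
inductive Label (k : ℕ)
  | unary | moveIn | zload (i : Fin (k + 1)) | zback (i : Fin (k + 1))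
  | inc | restA | row | restC | scan | clean
  deriving Fintype

/-- The registers of the finite control. -/
@[ext] structure Reg (N k : ℕ) where
  /-- the cell just read -/
  cell : Option (Cell N k)
  /-- the bit just read -/
  bit : Option Bool
  /-- the cell of the current row -/
  row : Cell N k
  /-- the marks on neighbours of the current row -/
  adj : Fin N → Bool
  /-- whether all rows so far passed the check -/
  ok : Bool
  /-- the marks on the first row -/
  fst : Option (Fin N → Bool)
  /-- the mark to be moved; the smaller ones are reset -/
  jst : Fin (N + 1)
  /-- whether the mark `jst` was on the previous cell -/
  pend : Bool
  /-- whether the next cell is the last one -/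
  last : Bool
  /-- the answer -/
  ans : Bool

instance (N k : ℕ) : Finite (Reg N k) :=
  Finite.of_injective (fun r : Reg N k =>
    (r.cell, r.bit, r.row, r.adj, r.ok, r.fst, r.jst, r.pend, r.last, r.ans)) (by
    intro r r' h
    simp only [Prod.mk.injEq] at h
    ext1 <;> tauto)

noncomputable instance (N k : ℕ) : Fintype (Reg N k) := Fintype.ofFinite _

/-- The initial registers. -/
def Reg.init (N k : ℕ) : Reg N k where
  cell := none
  bit := none
  row := .blank N k
  adj := fun _ => false
  ok := true
  fst := none
  jst := Fin.last N
  pend := false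
  last := true
  ans := false

/-- Record that a vertex belongs to the set number `i - 1`. -/
def setMember {N k : ℕ} (i : ℕ) (b : Bool) (x : Cell N k) : Cell N k :=
  (x.1, fun j => if j.val + 1 = i then b else x.2 j)

/-- The new content of a cell when the marks are moved: the mark `J` is placed there if `pend`,
the marks below `J` if `last`, and the marks above `J` are unchanged. -/
def moveMarks {N k : ℕ} (J : ℕ) (pend last : Bool) (x : Cell N k) : Cell N k :=
  (fun j => if j.val < J then last else if j.val = J then pend else x.1 j, x.2)

/-- Whether the mark `J` is on a cell. -/
def hasMark {N k : ℕ} (J : Fin (N + 1)) (x : Cell N k) : Bool :=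
  if h : J.val < N then x.1 ⟨J, h⟩ else false

open Classical in
/-- The first mark that is absent, or `N`. -/
noncomputable def firstAbsent {N : ℕ} (M : Fin N → Bool) : Fin (N + 1) :=
  if h : ∃ j, M j = false then
    ((Finset.univ.filter fun j => M j = false).min' (by
      obtain ⟨j, hj⟩ := h; exact ⟨j, by simp [hj]⟩)).castSucc
  else Fin.last N

variable {N k : ℕ} (Φ : (Fin N → Bool) → (Fin N → Bool) → (Fin k → Bool) → Bool)

/-- The program. -/
noncomputable def program : Label k → TM2.Stmt (Alphabet N k) (Label k) (Reg N k)
  | .unary =>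
    pop .inp (fun r o => { r with bit := o }) <|
    branch (fun r => r.bit == some true)
      (push .u (fun _ => Cell.blank N k) <| goto fun _ => .unary)
      (goto fun _ => .moveIn)
  | .moveIn =>
    pop .inp (fun r o => { r with bit := o }) <|
    branch (fun r => r.bit.isSome)
      (push .b (fun r => r.bit.getD false) <| goto fun _ => .moveIn)
      (goto fun _ => .zload (Fin.last k))
  -- The input now lies reversed on `b`, so the membership blocks come off last set first and last
  -- vertex first, matching the order of `u`. Label `i` stands for set `i - 1`; zero means done.
  | .zload i =>
    if i.val = 0 then goto fun _ => .inc else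
    pop .u (fun r o => { r with cell := o }) <|
    branch (fun r => r.cell.isSome)
      (pop .b (fun r o => { r with cell := r.cell.map (setMember i.val (o.getD false)) }) <|
        push .t (fun r => r.cell.getD (.blank N k)) <| goto fun _ => .zload i)
      (goto fun _ => .zback i)
  | .zback i =>
    pop .t (fun r o => { r with cell := o }) <|
    branch (fun r => r.cell.isSome)
      (push .u (fun r => r.cell.getD (.blank N k)) <| goto fun _ => .zback i)
      (goto fun _ => .zload ⟨i.val - 1, by omega⟩)
  -- Cells come from the last vertex to the first, so `pend` carries the mark `jst` from a vertex to
  -- its predecessor. The stale column copy on `d` is discarded while fresh copies go to `t` and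
  -- `c`.
  | .inc =>
    pop .u (fun r o => { r with cell := o }) <|
    branch (fun r => r.cell.isSome)
      (load (fun r => { r with
          cell := r.cell.map (moveMarks r.jst r.pend r.last)
          pend := (r.cell.map (hasMark r.jst)).getD false
          last := false }) <|
        pop .d (fun r _ => r) <|
        push .t (fun r => r.cell.getD (.blank N k)) <|
        push .c (fun r => r.cell.getD (.blank N k)) <| goto fun _ => .inc)
      (load (fun _ => .init N k) <| goto fun _ => .restA)
  | .restA =>
    pop .b (fun r o => { r with bit := o }) <|
    branch (fun r => r.bit.isSome)
      (push .a (fun r => r.bit.getD false) <| goto fun _ => .restA)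
      (goto fun _ => .row)
  | .row =>
    pop .t (fun r o => { r with cell := o }) <|
    branch (fun r => r.cell.isSome)
      (load (fun r => { r with
          row := r.cell.getD (.blank N k)
          adj := fun _ => false
          fst := r.fst.or (r.cell.map Prod.fst) }) <|
        push .u (fun r => r.cell.getD (.blank N k)) <| goto fun _ => .restC) <|
    -- `fst` is empty only if there are no vertices. No placement exists then, and the default
    -- `true` below leads to rejection.
    branch (fun r => r.fst.isSome && r.ok)
      (load (fun _ => { Reg.init N k with ans := true }) <| goto fun _ => .clean) <|
    -- The marks on the first vertex are the digits equal to zero, so this finds the lowest nonzero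
    -- digit, from which to borrow.
    load (fun r => { Reg.init N k with jst := firstAbsent (r.fst.getD fun _ => true) }) <|
    branch (fun r => decide (r.jst.val < N))
      (goto fun _ => .inc)
      (goto fun _ => .clean)
  | .restC =>
    pop .d (fun r o => { r with cell := o }) <|
    branch (fun r => r.cell.isSome)
      (push .c (fun r => r.cell.getD (.blank N k)) <| goto fun _ => .restC)
      (goto fun _ => .scan)
  | .scan =>
    pop .c (fun r o => { r with cell := o }) <|
    branch (fun r => r.cell.isSome)
      (pop .a (fun r o => { r with
          bit := o
          adj := fun j => r.adj j || ((r.cell.getD (.blank N k)).1 j && o.getD false) }) <|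
        push .d (fun r => r.cell.getD (.blank N k)) <|
        push .b (fun r => r.bit.getD false) <| goto fun _ => .scan)
      (load (fun r => { Reg.init N k with
          ok := r.ok && Φ r.row.1 r.adj r.row.2
          fst := r.fst }) <| goto fun _ => .row)
  -- A halting configuration must have initial registers and only the answer on the stacks. The
  -- answer is written once every pop finds its stack empty.
  | .clean =>
    pop .inp (fun r o => { r with ok := o.isNone }) <|
    pop .a (fun r o => { r with ok := r.ok && o.isNone }) <|
    pop .b (fun r o => { r with ok := r.ok && o.isNone }) <|
    pop .t (fun r o => { r with ok := r.ok && o.isNone }) <|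
    pop .u (fun r o => { r with ok := r.ok && o.isNone }) <|
    pop .c (fun r o => { r with ok := r.ok && o.isNone }) <|
    pop .d (fun r o => { r with ok := r.ok && o.isNone }) <|
    branch (fun r => r.ok)
      (push .inp (fun r => r.ans) <| load (fun _ => .init N k) halt)
      (goto fun _ => .clean)

/-- The machine. -/
noncomputable def machine : FinTM2 where
  K := StackName
  k₀ := .inp
  k₁ := .inp
  Γ := Alphabet N k
  Λ := Label k
  main := .unary
  σ := Reg N k
  initialState := .init N k
  Γk₀Fin := inferInstanceAs (Fintype Bool)
  m := program Φ

/-- The stacks with the given contents. -/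
def contents (i a b : List Bool) (t u c d : List (Cell N k)) :
    ∀ s : StackName, List (Alphabet N k s)
  | .inp => i
  | .a => a
  | .b => b
  | .t => t
  | .u => u
  | .c => c
  | .d => d

section update

variable (i a b w : List Bool) (t u c d x : List (Cell N k))

open Function

@[simp] theorem update_contents_inp :
    update (contents i a b t u c d) .inp w = contents w a b t u c d := by
  funext s; cases s <;> rfl

@[simp] theorem update_contents_a :
    update (contents i a b t u c d) .a w = contents i w b t u c d := by
  funext s; cases s <;> rfl

@[simp] theorem update_contents_b :
    update (contents i a b t u c d) .b w = contents i a w t u c d := by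
  funext s; cases s <;> rfl

@[simp] theorem update_contents_t :
    update (contents i a b t u c d) .t x = contents i a b x u c d := by
  funext s; cases s <;> rfl

@[simp] theorem update_contents_u :
    update (contents i a b t u c d) .u x = contents i a b t x c d := by
  funext s; cases s <;> rfl

@[simp] theorem update_contents_c :
    update (contents i a b t u c d) .c x = contents i a b t u x d := by
  funext s; cases s <;> rfl

@[simp] theorem update_contents_d :
    update (contents i a b t u c d) .d x = contents i a b t u c x := by
  funext s; cases s <;> rfl

end update

/-- The configurations of the machine. -/
abbrev Cfg (N k : ℕ) : Type := TM2.Cfg (Alphabet N k) (Label k) (Reg N k)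

/-- A configuration with the given label, registers and stacks. -/
def cfg (l : Option (Label k)) (r : Reg N k) (i a b : List Bool) (t u c d : List (Cell N k)) :
    Cfg N k := ⟨l, r, contents i a b t u c d⟩

/-- The machine gets from one configuration to another within `m` steps. -/
def RunsIn (m : ℕ) (x y : Cfg N k) : Prop :=
  ∃ s ≤ m, (flip bind (TM2.step (program Φ)))^[s] (some x) = some y

variable {Φ}

theorem RunsIn.refl (x : Cfg N k) : RunsIn Φ 0 x x := ⟨0, le_rfl, rfl⟩

theorem RunsIn.trans {m m' : ℕ} {x y z : Cfg N k} (h : RunsIn Φ m x y) (h' : RunsIn Φ m' y z) :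
    RunsIn Φ (m + m') x z := by
  obtain ⟨s, hs, hxy⟩ := h
  obtain ⟨s', hs', hyz⟩ := h'
  exact ⟨s' + s, by omega, by rw [Function.iterate_add_apply, hxy, hyz]⟩

theorem RunsIn.mono {m m' : ℕ} {x y : Cfg N k} (h : RunsIn Φ m x y) (hm : m ≤ m') :
    RunsIn Φ m' x y := by
  obtain ⟨s, hs, hxy⟩ := h
  exact ⟨s, hs.trans hm, hxy⟩

theorem RunsIn.single {x y : Cfg N k} (h : TM2.step (program Φ) x = some y) :
    RunsIn Φ 1 x y := ⟨1, le_rfl, h⟩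

theorem RunsIn.head {m : ℕ} {x y z : Cfg N k} (h : TM2.step (program Φ) x = some y)
    (h' : RunsIn Φ m y z) : RunsIn Φ (m + 1) x z :=
  ((RunsIn.single h).trans h').mono (by omega)

variable {r : Reg N k} {i a b : List Bool} {t u c d : List (Cell N k)}

theorem runsIn_unary (m : ℕ) (w : List Bool) :
    RunsIn Φ (m + 1) (cfg (some .unary) r (List.replicate m true ++ false :: w) a b t u c d)
      (cfg (some .moveIn) { r with bit := some false } w a b t
        (List.replicate m (Cell.blank N k) ++ u) c d) := by
  induction m generalizing r u with
  | zero => exact .single (by simp [cfg, program, contents])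
  | succ m ih =>
    refine .head (y := cfg (some .unary) { r with bit := some true }
      (List.replicate m true ++ false :: w) a b t (Cell.blank N k :: u) c d)
      (by simp [cfg, program, contents, List.replicate_succ]) ?_
    simpa [List.replicate_succ'] using ih

end MarkingMachine

end DisjointConnectedSubgraphs
-- Running times of the loops
namespace DisjointConnectedSubgraphs

namespace MarkingMachine

open Turing Turing.TM2.Stmt

variable {N k : ℕ} {Φ : (Fin N → Bool) → (Fin N → Bool) → (Fin k → Bool) → Bool}
  {r : Reg N k} {i a b : List Bool} {t u c d : List (Cell N k)}

theorem runsIn_moveIn : RunsIn Φ (i.length + 1) (cfg (some .moveIn) r i a b t u c d)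
    (cfg (some (.zload (Fin.last k))) { r with bit := none } [] a (i.reverse ++ b) t u c d) := by
  induction i generalizing r b with
  | nil => exact .single (by simp [cfg, program, contents])
  | cons x i ih =>
    refine .head (y := cfg (some .moveIn) { r with bit := some x } i a (x :: b) t u c d)
      (by simp [cfg, program, contents]) ?_
    simpa using ih

/-- Indexing both stacks by one list `l` keeps every bit aligned with its cell. -/
theorem runsIn_zload (n : Fin (k + 1)) (hn : n.val ≠ 0) (l : List ℕ) (F : ℕ → Cell N k)
    (g : ℕ → Bool) : RunsIn Φ (l.length + 1)
    (cfg (some (.zload n)) r i a (l.map g ++ b) t (l.map F) c d)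
    (cfg (some (.zback n)) { r with cell := none } i a b
      ((l.map fun v => setMember n.val (g v) (F v)).reverse ++ t) [] c d) := by
  induction l generalizing r t with
  | nil => exact .single (by simp [cfg, program, contents, hn])
  | cons v l ih =>
    refine .head (y := cfg (some (.zload n)) { r with cell := some (setMember n.val (g v) (F v)) }
      i a (l.map g ++ b) (setMember n.val (g v) (F v) :: t) (l.map F) c d)
      (by simp [cfg, program, contents, hn]) ?_
    simpa using ih

theorem runsIn_zback (n : Fin (k + 1)) : RunsIn Φ (t.length + 1)
    (cfg (some (.zback n)) r i a b t u c d)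
    (cfg (some (.zload ⟨n.val - 1, by omega⟩)) { r with cell := none } i a b []
      (t.reverse ++ u) c d) := by
  induction t generalizing r u with
  | nil => exact .single (by simp [cfg, program, contents])
  | cons x t ih =>
    refine .head (y := cfg (some (.zback n)) { r with cell := some x } i a b t (x :: u) c d)
      (by simp [cfg, program, contents]) ?_
    simpa using ih

/-- Reading the membership blocks. -/
theorem runsIn_zload_zero (hr : r = .init N k) (m : ℕ) (hm : m < k + 1) (n : ℕ)
    (z : ℕ → ℕ → Bool) (F : ℕ → Cell N k) :
    RunsIn Φ (m * (2 * n + 2) + 1)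
      (cfg (some (.zload ⟨m, hm⟩)) r i a
        (((List.range m).flatMap fun j => (List.range n).map (z j)).reverse ++ b)
        [] ((List.range n).map F).reverse c d)
      (cfg (some .inc) r i a b [] ((List.range n).map fun v =>
        ((F v).1, fun j : Fin k => if j.val < m then z j v else (F v).2 j)).reverse c d) := by
  induction m generalizing F with
  | zero => exact RunsIn.mono (m := 1) (.single (by simp [cfg, program])) (by omega)
  | succ m ih =>
    have h1 := runsIn_zload (Φ := Φ) (r := r) (i := i) (a := a) (t := []) (c := c) (d := d)
      (b := ((List.range m).flatMap fun j => (List.range n).map (z j)).reverse ++ b)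
      ⟨m + 1, hm⟩ (by simp) (List.range n).reverse F (z m)
    have h2 := runsIn_zback (Φ := Φ) (r := { r with cell := none }) (i := i) (a := a)
      (b := ((List.range m).flatMap fun j => (List.range n).map (z j)).reverse ++ b)
      (u := []) (c := c) (d := d)
      (t := (((List.range n).reverse).map fun v => setMember (m + 1) (z m v) (F v)).reverse ++ [])
      ⟨m + 1, hm⟩
    have h3 := ih (by omega) (fun v => setMember (m + 1) (z m v) (F v))
    have hc : ({ r with cell := none } : Reg N k) = r := by subst hr; rfl
    rw [hc] at h1 h2
    have key : (fun v => ((setMember (m + 1) (z m v) (F v)).1,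
        fun j : Fin k => if j.val < m then z j v else (setMember (m + 1) (z m v) (F v)).2 j)) =
        fun v => ((F v).1, fun j : Fin k => if j.val < m + 1 then z j v else (F v).2 j) := by
      funext v
      simp only [setMember, Prod.mk.injEq, true_and]
      funext j
      rcases lt_trichotomy j.val m with h | h | h
      · simp [h, Nat.lt_succ_of_lt h]
      · simp [h]
      · simp [h.not_gt, h.ne', show ¬ j.val < m + 1 by omega]
    rw [key] at h3
    have := (h1.trans h2).trans
      (by simpa only [List.map_reverse, List.reverse_reverse, List.append_nil,
        Nat.add_sub_cancel] using h3)
    simp only [List.range_succ, List.flatMap_append, List.flatMap_singleton, List.reverse_append,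
      List.append_assoc]
    simp only [List.map_reverse] at this
    refine this.mono ?_
    simp
    ring_nf
    omega

/-- The new content of the cell `v` of a tape with `m` cells after the marks are moved. -/
def movedCell (J : Fin (N + 1)) (pend last : Bool) (m : ℕ) (F : ℕ → Cell N k) (v : ℕ) : Cell N k :=
  moveMarks J (if v + 1 = m then pend else hasMark J (F (v + 1)))
    (if v + 1 = m then last else false) (F v)

theorem runsIn_inc (m : ℕ) (F : ℕ → Cell N k) (hd : d.length ≤ m) :
    RunsIn Φ (m + 1) (cfg (some .inc) r i a b t ((List.range m).map F).reverse c d)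
      (cfg (some .restA) (.init N k) i a b
        ((List.range m).map (movedCell r.jst r.pend r.last m F) ++ t) []
        ((List.range m).map (movedCell r.jst r.pend r.last m F) ++ c) []) := by
  induction m generalizing r t c d with
  | zero =>
    obtain rfl : d = [] := by simpa using hd
    exact .single (by simp [cfg, program, contents])
  | succ m ih =>
    refine .head (y := cfg (some .inc) { r with
      cell := some (moveMarks r.jst r.pend r.last (F m))
      pend := hasMark r.jst (F m), last := false } i a b
      (movedCell r.jst r.pend r.last (m + 1) F m :: t) ((List.range m).map F).reverse
      (movedCell r.jst r.pend r.last (m + 1) F m :: c) d.tail)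
      (by simp [cfg, program, contents, List.range_succ, movedCell]) ?_
    -- After the cell `m`, the rest behaves like a shorter tape whose incoming mark is the one found
    -- on that cell.
    have key : (List.range m).map (movedCell r.jst (hasMark r.jst (F m)) false m F) =
        (List.range m).map (movedCell r.jst r.pend r.last (m + 1) F) := by
      refine List.map_congr_left fun v hv => ?_
      have hv : v < m := List.mem_range.1 hv
      simp only [movedCell, show ¬ v + 1 = m + 1 by omega, if_false]
      by_cases h : v + 1 = m <;> simp [h]
    rw [List.range_succ, List.map_append, List.append_assoc, List.append_assoc]
    have := ih (r := { r with
      cell := some (moveMarks r.jst r.pend r.last (F m))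
      pend := hasMark r.jst (F m), last := false })
      (t := movedCell r.jst r.pend r.last (m + 1) F m :: t)
      (c := movedCell r.jst r.pend r.last (m + 1) F m :: c) (d := d.tail) (by simp; omega)
    rw [key] at this
    exact this

theorem runsIn_restA (hr : r = .init N k) : RunsIn Φ (b.length + 1)
    (cfg (some .restA) r i a b t u c d)
    (cfg (some .row) r i (b.reverse ++ a) [] t u c d) := by
  have key : ∀ r : Reg N k, RunsIn Φ (b.length + 1) (cfg (some .restA) r i a b t u c d)
      (cfg (some .row) { r with bit := none } i (b.reverse ++ a) [] t u c d) := by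
    intro r
    induction b generalizing r a with
    | nil => exact .single (by simp [cfg, program, contents])
    | cons x b ih =>
      refine .head (y := cfg (some .restA) { r with bit := some x } i (x :: a) b t u c d)
        (by simp [cfg, program, contents]) ?_
      simpa using ih { r with bit := some x }
  have := key r
  subst hr
  exact this

theorem runsIn_restC : RunsIn Φ (d.length + 1) (cfg (some .restC) r i a b t u c d)
    (cfg (some .scan) { r with cell := none } i a b t u (d.reverse ++ c) []) := by
  induction d generalizing r c with
  | nil => exact .single (by simp [cfg, program, contents])
  | cons x d ih =>
    refine .head (y := cfg (some .restC) { r with cell := some x } i a b t u (x :: c) d)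
      (by simp [cfg, program, contents]) ?_
    simpa using ih

/-- The registers between two rows. -/
def Reg.between (o : Bool) (f : Option (Fin N → Bool)) : Reg N k :=
  { Reg.init N k with ok := o, fst := f }

theorem runsIn_scan (l : List ℕ) (F : ℕ → Cell N k) (g : ℕ → Bool) :
    RunsIn Φ (l.length + 1) (cfg (some .scan) r i (l.map g ++ a) b t u (l.map F) d)
      (cfg (some .row) (.between (r.ok && Φ r.row.1 (fun j => r.adj j ||
          l.any fun v => (F v).1 j && g v) r.row.2) r.fst) i a
        ((l.map g).reverse ++ b) t u [] ((l.map F).reverse ++ d)) := by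
  induction l generalizing r b d with
  | nil => exact .single (by simp [cfg, program, contents, Reg.between])
  | cons v l ih =>
    refine .head (y := cfg (some .scan) { r with
      cell := some (F v), bit := some (g v),
      adj := fun j => r.adj j || ((F v).1 j && g v) } i (l.map g ++ a) (g v :: b) t u
      (l.map F) (F v :: d))
      (by simp [cfg, program, contents]) ?_
    simpa [Bool.or_assoc] using ih (r := { r with
      cell := some (F v), bit := some (g v),
      adj := fun j => r.adj j || ((F v).1 j && g v) }) (b := g v :: b) (d := F v :: d)

/-- The check of one row. -/
def checkRow (Φ : (Fin N → Bool) → (Fin N → Bool) → (Fin k → Bool) → Bool) (n : ℕ)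
    (F : ℕ → Cell N k) (g : ℕ → ℕ → Bool) (v : ℕ) : Bool :=
  Φ (F v).1 (fun j => (List.range n).any fun w => (F w).1 j && g v w) (F v).2

/-- The hypothesis `hcd` fixes the column tape but not its head position; `restC` rewinds it first.
-/
theorem runsIn_row (n : ℕ) (F : ℕ → Cell N k) (g : ℕ → ℕ → Bool) (o : Bool)
    (f : Option (Fin N → Bool)) (v : ℕ) (hcd : d.reverse ++ c = (List.range n).map F) :
    RunsIn Φ (2 * n + 3)
      (cfg (some .row) (.between o f) i ((List.range n).map (g v) ++ a) b (F v :: t) u c d)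
      (cfg (some .row) (.between (o && checkRow Φ n F g v) (f.or (some (F v).1))) i a
        (((List.range n).map (g v)).reverse ++ b) t (F v :: u) []
        ((List.range n).map F).reverse) := by
  have hlen : d.length ≤ n := by
    have := congrArg List.length hcd
    simp at this
    omega
  have h1 : RunsIn Φ 1
      (cfg (some .row) (.between o f) i ((List.range n).map (g v) ++ a) b (F v :: t) u c d)
      (cfg (some .restC) { Reg.between (k := k) o f with
        cell := some (F v), row := F v, fst := f.or (some (F v).1) }
        i ((List.range n).map (g v) ++ a) b t (F v :: u) c d) :=
    .single (by simp [cfg, program, contents, Reg.between, Reg.init])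
  have h2 := h1.trans runsIn_restC
  rw [hcd] at h2
  have h3 := h2.trans (runsIn_scan (List.range n) F (g v))
  simp only [List.append_nil] at h3
  refine (RunsIn.mono h3 (by simp; omega))

/-- The head of the column tape may be anywhere before the first row but is at the end after any
row; `hl` covers the case of no row. -/
theorem runsIn_rows (n : ℕ) (F : ℕ → Cell N k) (g : ℕ → ℕ → Bool) (l : List ℕ) (o : Bool)
    (f : Option (Fin N → Bool)) (hcd : d.reverse ++ c = (List.range n).map F)
    (hl : l ≠ [] ∨ c = []) :
    RunsIn Φ (l.length * (2 * n + 3))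
      (cfg (some .row) (.between o f) i (l.flatMap fun v => (List.range n).map (g v)) b
        (l.map F) u c d)
      (cfg (some .row) (.between (o && l.all (checkRow Φ n F g))
        (f.or (l.head?.map fun v => (F v).1))) i []
        ((l.flatMap fun v => (List.range n).map (g v)).reverse ++ b) [] ((l.map F).reverse ++ u) []
        ((List.range n).map F).reverse) := by
  induction l generalizing o f b u c d with
  | nil =>
    obtain rfl : c = [] := by simpa using hl
    rw [List.append_nil] at hcd
    rw [← hcd]
    simpa using RunsIn.refl _
  | cons v l ih =>
    have h1 := runsIn_row (Φ := Φ) (i := i) (b := b) (t := l.map F) (u := u)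
      (a := l.flatMap fun v => (List.range n).map (g v)) n F g o f v hcd
    have h2 := h1.trans (ih _ _ (by simp) (Or.inr rfl))
    have h4 : (f.or (some (F v).1)).or (l.head?.map fun v => (F v).1) = f.or (some (F v).1) := by
      cases f <;> rfl
    rw [h4] at h2
    simp only [List.flatMap_cons, List.map_cons, List.all_cons, List.reverse_append,
      List.append_assoc, List.reverse_cons, List.head?_cons, Option.map_some, List.length_cons,
      List.singleton_append, ← Bool.and_assoc] at h2 ⊢
    exact h2.mono (by ring_nf; omega)

theorem runsIn_clean (L : ℕ) (hi : i.length ≤ L) (ha : a.length ≤ L) (hb : b.length ≤ L)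
    (ht : t.length ≤ L) (hu : u.length ≤ L) (hc : c.length ≤ L) (hd : d.length ≤ L) :
    RunsIn Φ (L + 1) (cfg (some .clean) r i a b t u c d)
      (cfg none (.init N k) [r.ans] [] [] [] [] [] []) := by
  induction L generalizing r i a b t u c d with
  | zero =>
    simp only [Nat.le_zero, List.length_eq_zero_iff] at hi ha hb ht hu hc hd
    subst hi ha hb ht hu hc hd
    exact .single (by simp [cfg, program, contents])
  | succ L ih =>
    by_cases h : i = [] ∧ a = [] ∧ b = [] ∧ t = [] ∧ u = [] ∧ c = [] ∧ d = []
    · obtain ⟨rfl, rfl, rfl, rfl, rfl, rfl, rfl⟩ := h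
      exact RunsIn.mono (m := 1) (.single (by simp [cfg, program, contents])) (by omega)
    · refine .head (y := cfg (some .clean) { r with ok := false }
        i.tail a.tail b.tail t.tail u.tail c.tail d.tail) ?_
        (ih (r := { r with ok := false }) ?_ ?_ ?_ ?_ ?_ ?_ ?_)
      · have h' : (i.head?.isNone && a.head?.isNone && b.head?.isNone && t.head?.isNone &&
            u.head?.isNone && c.head?.isNone && d.head?.isNone) = false := by
          rw [Bool.eq_false_iff]
          intro h'
          simp only [Bool.and_eq_true, Option.isNone_iff_eq_none, List.head?_eq_none_iff] at h'
          tauto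
        simp [cfg, program, contents, h']
      all_goals simp; omega

theorem runsIn_accept (f : Fin N → Bool) :
    RunsIn Φ 1 (cfg (some .row) (.between true (some f)) i a b [] u c d)
      (cfg (some .clean) { Reg.init N k with ans := true } i a b [] u c d) :=
  .single (by simp [cfg, program, contents, Reg.between])

theorem runsIn_next (f : Fin N → Bool) (hf : (firstAbsent f).val < N) :
    RunsIn Φ 1 (cfg (some .row) (.between false (some f)) i a b [] u c d)
      (cfg (some .inc) { Reg.init N k with jst := firstAbsent f } i a b [] u c d) :=
  .single (by simp [cfg, program, contents, Reg.between, hf])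

theorem runsIn_reject (f : Fin N → Bool) (hf : ¬ (firstAbsent f).val < N) :
    RunsIn Φ 1 (cfg (some .row) (.between false (some f)) i a b [] u c d)
      (cfg (some .clean) { Reg.init N k with jst := firstAbsent f } i a b [] u c d) :=
  .single (by simp [cfg, program, contents, Reg.between, hf])

theorem firstAbsent_of_forall {f : Fin N → Bool} (hf : ∀ j, f j = true) :
    firstAbsent f = Fin.last N := by
  simp [firstAbsent, hf]

theorem runsIn_reject_of_none :
    RunsIn Φ 1 (cfg (some .row) (.between true none) i a b [] u c d)
      (cfg (some .clean) (.init N k) i a b [] u c d) :=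
  .single (by
    simp [cfg, program, contents, Reg.between, firstAbsent_of_forall, Reg.init])

theorem firstAbsent_spec {f : Fin N → Bool} (hf : (firstAbsent f).val < N) :
    f ⟨_, hf⟩ = false ∧ ∀ j : Fin N, j.val < (firstAbsent f).val → f j = true := by
  unfold firstAbsent at hf ⊢
  split_ifs at hf ⊢ with h
  · have hne : (Finset.univ.filter fun j => f j = false).Nonempty := by
      obtain ⟨j, hj⟩ := h; exact ⟨j, by simp [hj]⟩
    refine ⟨by simpa using Finset.min'_mem _ hne, fun j hj => ?_⟩
    by_contra hj'
    exact (Finset.min'_le _ j (by simpa using hj')).not_gt hj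
  · simp at hf

theorem forall_of_not_firstAbsent_lt {f : Fin N → Bool} (hf : ¬ (firstAbsent f).val < N)
    (j : Fin N) : f j = true := by
  unfold firstAbsent at hf
  split_ifs at hf with h
  · exact absurd (Fin.castSucc_lt_last _) (fun h' => hf h')
  · simpa using not_exists.1 h j

end MarkingMachine

end DisjointConnectedSubgraphs
-- Counting down through all placements
namespace DisjointConnectedSubgraphs

namespace MarkingMachine

open Turing Finset

variable {N k : ℕ} {Φ : (Fin N → Bool) → (Fin N → Bool) → (Fin k → Bool) → Bool}

/-- The cell of the vertex `v` when the mark `j` is placed on `x j` and the set number `j`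
is given by `z j`. -/
def cellAt (x : Fin N → ℕ) (z : ℕ → ℕ → Bool) (v : ℕ) : Cell N k :=
  (fun j => decide (x j = v), fun j => z j v)

/-- For `J = N` the hypothesis `heq` is vacuous and all marks go to the last vertex, which is how
the search starts. The bound `x j < n` ensures that the mark `J` does not end on the last vertex,
where `pend` is `false`. -/
theorem movedCell_cellAt {n : ℕ} {J : Fin (N + 1)} {x y : Fin N → ℕ} (z : ℕ → ℕ → Bool)
    (hlt : ∀ j : Fin N, j.val < J.val → y j = n - 1)
    (heq : ∀ j : Fin N, j.val = J.val → y j + 1 = x j ∧ x j < n)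
    (hgt : ∀ j : Fin N, J.val < j.val → y j = x j) {v : ℕ} (hv : v < n) :
    movedCell J false true n (cellAt x z) v = (cellAt y z v : Cell N k) := by
  refine Prod.ext (funext fun j => ?_) rfl
  simp only [movedCell, moveMarks, cellAt]
  rcases lt_trichotomy j.val J.val with h | h | h
  · have := hlt j h
    rw [if_pos h]
    by_cases hn : v + 1 = n
    · rw [if_pos hn, eq_comm, decide_eq_true_iff]; omega
    · rw [if_neg hn, eq_comm, decide_eq_false_iff_not]; omega
  · obtain ⟨h1, h2⟩ := heq j h
    rw [if_neg (by omega), if_pos h]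
    have hJ : (⟨J.val, by omega⟩ : Fin N) = j := Fin.ext h.symm
    by_cases hn : v + 1 = n
    · rw [if_pos hn, eq_comm, decide_eq_false_iff_not]; omega
    · rw [if_neg hn]
      simp only [hasMark, show J.val < N by omega, dif_pos, hJ]
      exact decide_eq_decide.2 (by omega)
  · rw [if_neg (by omega), if_neg (by omega), hgt j h]

/-- Subtraction of one with borrow in base `n`. The first half handles the digits below `J`, which
turn from all `0` to all `n - 1`. -/
theorem sum_decrement {n J : ℕ} {x y : ℕ → ℕ} (h0 : ∀ j < J, x j = 0)
    (hlt : ∀ j < J, y j + 1 = n) (heq : y J + 1 = x J) (hgt : ∀ j, J < j → y j = x j) (m : ℕ) :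
    (m ≤ J → ∑ j ∈ range m, y j * n ^ j + 1 = n ^ m ∧ ∑ j ∈ range m, x j * n ^ j = 0) ∧
    (J < m → ∑ j ∈ range m, y j * n ^ j + 1 = ∑ j ∈ range m, x j * n ^ j) := by
  induction m with
  | zero => simp
  | succ m ih =>
    simp only [sum_range_succ]
    refine ⟨fun h => ?_, fun h => ?_⟩
    · obtain ⟨h1, h2⟩ := ih.1 (by omega)
      refine ⟨?_, by simp [h2, h0 m (by omega)]⟩
      calc _ = (∑ j ∈ range m, y j * n ^ j + 1) + y m * n ^ m := by ring
        _ = (y m + 1) * n ^ m := by rw [h1]; ring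
        _ = _ := by rw [hlt m (by omega), pow_succ']
    · rcases Nat.lt_succ_iff_lt_or_eq.1 h with h | rfl
      · rw [← ih.2 h, hgt m h]; ring
      · obtain ⟨h1, h2⟩ := ih.1 le_rfl
        calc _ = (∑ j ∈ range J, y j * n ^ j + 1) + y J * n ^ J := by ring
          _ = (y J + 1) * n ^ J := by rw [h1]; ring
          _ = _ := by rw [heq, h2, zero_add]

theorem exists_decrement {n : ℕ} (x : Fin N → Fin n) (J : Fin N) (h0 : ∀ j < J, (x j).val = 0)
    (hJ : (x J).val ≠ 0) : ∃ y : Fin N → Fin n,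
      (∀ j < J, (y j).val + 1 = n) ∧ (y J).val + 1 = x J ∧ (∀ j, J < j → y j = x j) ∧
      (finFunctionFinEquiv y).val + 1 = (finFunctionFinEquiv x).val := by
  have hn : 0 < n := (x J).pos
  let y : Fin N → Fin n := fun j =>
    if j < J then ⟨n - 1, by omega⟩ else if j = J then ⟨(x J).val - 1, by omega⟩ else x j
  have h1 : ∀ j < J, (y j).val + 1 = n := fun j hj => by simp [y, hj]; omega
  have h2 : (y J).val + 1 = x J := by simp [y]; omega
  have h3 : ∀ j, J < j → y j = x j := fun j hj => by simp [y, hj.not_gt, hj.ne']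
  refine ⟨y, h1, h2, h3, ?_⟩
  rw [finFunctionFinEquiv_apply, finFunctionFinEquiv_apply]
  -- Digits are extended by zero so that `sum_decrement` can run over initial ranges.
  let ext : (Fin N → Fin n) → ℕ → ℕ := fun f j => if h : j < N then f ⟨j, h⟩ else 0
  have key : ∀ f : Fin N → Fin n, ∑ i, (f i).val * n ^ i.val = ∑ j ∈ range N, ext f j * n ^ j :=
    fun f => by
      rw [← Fin.sum_univ_eq_sum_range (fun j => ext f j * n ^ j)]
      exact sum_congr rfl fun i _ => by simp [ext]
  rw [key, key]
  refine (sum_decrement (J := J.val) ?_ ?_ ?_ ?_ N).2 J.2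
  · intro j hj
    simpa [ext, hj.trans J.2] using h0 ⟨j, hj.trans J.2⟩ hj
  · intro j hj
    simpa [ext, hj.trans J.2] using h1 ⟨j, hj.trans J.2⟩ hj
  · simpa [ext] using h2
  · intro j hj
    by_cases h : j < N
    · simpa [ext, h] using congrArg Fin.val (h3 ⟨j, h⟩ hj)
    · simp [ext, h]

/-- Whether every row passes the check when the marks are placed by `x`. -/
def checkAll (Φ : (Fin N → Bool) → (Fin N → Bool) → (Fin k → Bool) → Bool) (n : ℕ)
    (g z : ℕ → ℕ → Bool) (x : Fin N → ℕ) : Bool :=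
  (List.range n).all (checkRow Φ n (cellAt x z) g)

/-- The adjacency matrix of `g`, row by row. -/
def matrix (n : ℕ) (g : ℕ → ℕ → Bool) : List Bool :=
  (List.range n).flatMap fun v => (List.range n).map (g v)

theorem length_matrix (n : ℕ) (g : ℕ → ℕ → Bool) : (matrix n g).length = n * n := by
  simp [matrix]

/-- The content of a vertex tape when the marks are placed by `x`. -/
def tape (n : ℕ) (z : ℕ → ℕ → Bool) (x : Fin N → ℕ) : List (Cell N k) :=
  (List.range n).map (cellAt x z)

theorem length_tape (n : ℕ) (z : ℕ → ℕ → Bool) (x : Fin N → ℕ) :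
    (tape n z x : List (Cell N k)).length = n := by
  simp [tape]

theorem runsIn_checkAll {n : ℕ} (hn : 0 < n) (g z : ℕ → ℕ → Bool) (x : Fin N → ℕ) :
    RunsIn Φ (n * (2 * n + 3))
      (cfg (some .row) (.init N k) [] (matrix n g) [] (tape n z x) [] (tape n z x) [])
      (cfg (some .row) (.between (checkAll Φ n g z x) (some fun j => decide (x j = 0))) [] []
        (matrix n g).reverse [] (tape n z x).reverse [] (tape n z x).reverse) := by
  have h := runsIn_rows (Φ := Φ) (i := []) (b := []) (u := []) (c := tape n z x) (d := []) n
    (cellAt x z) g (List.range n) true none rfl (Or.inl (by simp [hn.ne']))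
  have hh : (List.range n).head? = some 0 := by
    obtain ⟨n, rfl⟩ := Nat.exists_eq_succ_of_ne_zero hn.ne'
    simp [List.range_succ_eq_map]
  simp only [List.length_range, List.append_nil, Bool.true_and, Option.none_or, hh,
    Option.map_some] at h
  exact h

theorem runsIn_advance {n : ℕ} (g z : ℕ → ℕ → Bool) {J : Fin (N + 1)} {x y : Fin N → ℕ}
    {d : List (Cell N k)} (hd : d.length ≤ n)
    (hlt : ∀ j : Fin N, j.val < J.val → y j = n - 1)
    (heq : ∀ j : Fin N, j.val = J.val → y j + 1 = x j ∧ x j < n)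
    (hgt : ∀ j : Fin N, J.val < j.val → y j = x j) :
    RunsIn Φ ((n + 1) + (n * n + 1))
      (cfg (some .inc) { Reg.init N k with jst := J } [] [] (matrix n g).reverse []
        (tape n z x).reverse [] d)
      (cfg (some .row) (.init N k) [] (matrix n g) [] (tape n z y) [] (tape n z y) []) := by
  have h1 := runsIn_inc (Φ := Φ) (r := { Reg.init N k with jst := J }) (i := []) (a := [])
    (b := (matrix n g).reverse) (t := []) (c := []) n (cellAt x z) hd
  have h2 : (List.range n).map (movedCell J false true n (cellAt x z)) =
      (tape n z y : List (Cell N k)) :=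
    List.map_congr_left fun v hv =>
      movedCell_cellAt z hlt heq hgt (List.mem_range.1 hv)
  simp only [Reg.init, h2, List.append_nil] at h1
  have h3 := runsIn_restA (Φ := Φ) (r := .init N k) rfl (i := []) (a := [])
    (b := (matrix n g).reverse) (t := tape n z y) (u := []) (c := tape n z y) (d := [])
  rw [List.length_reverse, length_matrix, List.reverse_reverse, List.append_nil] at h3
  exact h1.trans h3

/-- A bound on the time for one placement of the marks. -/
def roundTime (n : ℕ) : ℕ := n * (2 * n + 3) + 1 + ((n + 1) + (n * n + 1))

/-- Induction on the number coded by the current placement: each value costs one round, and a failed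
check at a nonzero code leads to the next smaller one. -/
theorem runsIn_search {n : ℕ} (hn : 0 < n) (g z : ℕ → ℕ → Bool) (m : ℕ) (x : Fin N → Fin n)
    (hx : (finFunctionFinEquiv x).val = m) :
    RunsIn Φ ((m + 1) * roundTime n + (n * n + n + 1))
      (cfg (some .row) (.init N k) [] (matrix n g) [] (tape n z fun j => x j) []
        (tape n z fun j => x j) [])
      (cfg none (.init N k) [decide (∃ y : Fin N → Fin n, (finFunctionFinEquiv y).val ≤ m ∧
        checkAll Φ n g z (fun j => y j) = true)] [] [] [] [] [] []) := by
  have hclean : ∀ {r : Reg N k} {x : Fin N → ℕ}, RunsIn Φ (n * n + n + 1)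
      (cfg (some .clean) r [] [] (matrix n g).reverse [] (tape n z x).reverse []
        (tape n z x).reverse)
      (cfg none (.init N k) [r.ans] [] [] [] [] [] []) := fun {r x} =>
    runsIn_clean _ (by simp) (by simp) (by simp [length_matrix]) (by simp)
      (by simp [length_tape]) (by simp) (by simp [length_tape])
  induction m generalizing x with
  | zero =>
    have h1 := runsIn_checkAll (Φ := Φ) hn g z fun j => (x j).val
    have huniq : ∀ y : Fin N → Fin n, (finFunctionFinEquiv y).val ≤ 0 ↔ y = x := fun y => by
      rw [← finFunctionFinEquiv.injective.eq_iff, Fin.ext_iff, hx, Nat.le_zero]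
    simp only [huniq, exists_eq_left]
    cases hc : checkAll Φ n g z fun j => (x j).val with
    | true =>
      rw [hc] at h1
      refine ((h1.trans (runsIn_accept _)).trans hclean).mono ?_
      simp only [roundTime]; omega
    | false =>
      rw [hc] at h1
      have hz : ∀ j, (x j).val = 0 := fun j => by
        rw [finFunctionFinEquiv_apply, sum_eq_zero_iff] at hx
        simpa [hn.ne'] using hx j (mem_univ _)
      refine ((h1.trans (runsIn_reject _ ?_)).trans hclean).mono ?_
      · rw [firstAbsent_of_forall (by simp [hz])]; simp
      · simp only [roundTime]; omega
  | succ m ih =>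
    have h1 := runsIn_checkAll (Φ := Φ) hn g z fun j => (x j).val
    cases hc : checkAll Φ n g z fun j => (x j).val with
    | true =>
      rw [hc] at h1
      rw [decide_eq_true ⟨x, hx.le, hc⟩]
      refine ((h1.trans (runsIn_accept _)).trans hclean).mono ?_
      simp only [roundTime]
      nlinarith
    | false =>
      rw [hc] at h1
      -- A code `m + 1` has a nonzero digit.
      have hlt : (firstAbsent fun j => decide ((x j).val = 0)).val < N := by
        by_contra h
        have hz := forall_of_not_firstAbsent_lt h
        simp only [decide_eq_true_eq] at hz
        rw [finFunctionFinEquiv_apply] at hx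
        simp [hz] at hx
      obtain ⟨hJ, h0⟩ := firstAbsent_spec hlt
      simp only [decide_eq_false_iff_not, decide_eq_true_eq] at hJ h0
      obtain ⟨y, hy1, hy2, hy3, hy⟩ := exists_decrement x ⟨_, hlt⟩ (fun j hj => h0 j hj) hJ
      have h2 := h1.trans (runsIn_next _ hlt)
      have h3 := h2.trans (runsIn_advance (Φ := Φ) g z (x := fun j => (x j).val)
        (y := fun j => (y j).val) (by simp [length_tape]) (fun j hj => by have := hy1 j hj; omega)
        (fun j hj => by
          obtain rfl : j = ⟨_, hlt⟩ := Fin.ext hj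
          exact ⟨hy2, (x _).2⟩)
        (fun j hj => congrArg Fin.val (hy3 j hj)))
      have h4 := h3.trans (ih y (by omega))
      -- The only placement with code `m + 1` is `x`, which has just failed.
      have hiff : (∃ w : Fin N → Fin n, (finFunctionFinEquiv w).val ≤ m + 1 ∧
          checkAll Φ n g z (fun j => w j) = true) ↔
          ∃ w : Fin N → Fin n, (finFunctionFinEquiv w).val ≤ m ∧
          checkAll Φ n g z (fun j => w j) = true := by
        refine ⟨fun ⟨w, hw, hw'⟩ => ⟨w, ?_, hw'⟩, fun ⟨w, hw, hw'⟩ => ⟨w, by omega, hw'⟩⟩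
        rcases Nat.le_succ_iff.1 hw with h | h
        · exact h
        · have : w = x := finFunctionFinEquiv.injective (Fin.ext (by omega))
          subst this
          simp [hc] at hw'
      simp only [hiff]
      refine h4.mono ?_
      simp only [roundTime]
      ring_nf
      omega

/-- The input string. -/
def input (n k : ℕ) (g z : ℕ → ℕ → Bool) : List Bool :=
  List.replicate n true ++ false ::
    (matrix n g ++ (List.range k).flatMap fun j => (List.range n).map (z j))

theorem length_input (n k : ℕ) (g z : ℕ → ℕ → Bool) :
    (input n k g z).length = n + 1 + n * n + k * n := by
  simp [input, length_matrix]; ring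

theorem runsIn_load (n : ℕ) (g z : ℕ → ℕ → Bool) :
    RunsIn Φ ((n + 1) + (n * n + k * n + 1) + (k * (2 * n + 2) + 1) + ((n + 1) + (n * n + 1)))
      (cfg (some .unary) (.init N k) (input n k g z) [] [] [] [] [] [])
      (cfg (some .row) (.init N k) [] (matrix n g) [] (tape n z fun _ => n - 1) []
        (tape n z fun _ => n - 1) []) := by
  have h1 := runsIn_unary (Φ := Φ) (r := .init N k) (a := []) (b := []) (t := []) (u := [])
    (c := []) (d := []) n (matrix n g ++ (List.range k).flatMap fun j => (List.range n).map (z j))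
  have h2 := h1.trans runsIn_moveIn
  have hblank : List.replicate n (Cell.blank N k) ++ [] =
      ((List.range n).map fun _ => Cell.blank N k).reverse := by
    simp
  rw [hblank, List.reverse_append, List.append_assoc] at h2
  have h3 := h2.trans (runsIn_zload_zero rfl k (by omega) n z (fun _ => Cell.blank N k))
  -- Unmarked cells are treated as marks placed on the nonexistent vertex `n`; advancing with `J =
  -- N` then puts every mark on `n - 1`.
  have h4 : ((List.range n).map fun v => ((Cell.blank N k).1,
      fun j : Fin k => if j.val < k then z j v else (Cell.blank N k).2 j)) =
      tape n z (fun _ => n) :=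
    List.map_congr_left fun v hv => by
      have hv := List.mem_range.1 hv
      simp [cellAt, Cell.blank, hv.ne']
  rw [h4, List.append_nil] at h3
  have h5 := h3.trans (runsIn_advance (Φ := Φ) (J := Fin.last N) g z (x := fun _ => n)
    (y := fun _ => n - 1) (d := []) (by simp)
    (fun _ _ => rfl) (fun j hj => absurd hj j.2.ne) (fun j hj => absurd hj j.2.not_gt))
  refine h5.mono ?_
  simp only [List.length_append, length_matrix, List.length_flatMap, List.length_map,
    List.length_range, List.map_const', List.sum_replicate, smul_eq_mul]
  omega

theorem runsIn_empty (g z : ℕ → ℕ → Bool) (x : Fin N → ℕ) : RunsIn Φ 2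
    (cfg (some .row) (.init N k) [] (matrix 0 g) [] (tape 0 z x) [] (tape 0 z x) [])
    (cfg none (.init N k) [false] [] [] [] [] [] []) :=
  runsIn_reject_of_none.trans (runsIn_clean 0 le_rfl le_rfl le_rfl le_rfl le_rfl le_rfl le_rfl)

/-- A bound on the running time, in terms of the length of the input. -/
noncomputable def timeBound (N k : ℕ) : Polynomial ℕ :=
  let X : Polynomial ℕ := Polynomial.X
  ((X + 1) + (X * X + (k : Polynomial ℕ) * X + 1) + ((k : Polynomial ℕ) * (2 * X + 2) + 1) +
    ((X + 1) + (X * X + 1))) +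
  ((X ^ N + 1) * (X * (2 * X + 3) + 1 + ((X + 1) + (X * X + 1))) + (X * X + X + 1))

theorem runsIn_machine (hN : N ≠ 0) (n : ℕ) (g z : ℕ → ℕ → Bool) :
    RunsIn Φ ((timeBound N k).eval (input n k g z).length)
      (cfg (some .unary) (.init N k) (input n k g z) [] [] [] [] [] [])
      (cfg none (.init N k) [decide (∃ x : Fin N → Fin n, checkAll Φ n g z (fun j => x j) = true)]
        [] [] [] [] [] []) := by
  have hX : n ≤ (input n k g z).length := by rw [length_input]; omega
  set X := (input n k g z).length
  have h1 := runsIn_load (Φ := Φ) n g z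
  rcases Nat.eq_zero_or_pos n with rfl | hn
  · have hno : ¬ ∃ x : Fin N → Fin 0, checkAll Φ 0 g z (fun j => x j) = true :=
      fun ⟨x, _⟩ => (x ⟨0, Nat.pos_of_ne_zero hN⟩).elim0
    rw [decide_eq_false hno]
    refine (h1.trans (runsIn_empty g z _)).mono ?_
    simp only [timeBound, Polynomial.eval_add, Polynomial.eval_mul, Polynomial.eval_X,
      Polynomial.eval_one, Polynomial.eval_pow, Polynomial.eval_natCast, Polynomial.eval_ofNat,
      Nat.cast_id]
    have h3 : k * 2 ≤ k * (2 * X + 2) := Nat.mul_le_mul_left _ (by omega)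
    have h4 : 1 * 3 ≤ (X ^ N + 1) * (X * (2 * X + 3) + 1 + ((X + 1) + (X * X + 1))) :=
      Nat.mul_le_mul (by omega) (by omega)
    omega
  · have h2 := runsIn_search (Φ := Φ) hn g z _ (fun _ => ⟨n - 1, by omega⟩) rfl
    -- The starting placement has all digits `n - 1`, hence the largest code, so none is missed.
    have hall : (∃ y : Fin N → Fin n, (finFunctionFinEquiv y).val ≤
        (finFunctionFinEquiv fun _ : Fin N => (⟨n - 1, by omega⟩ : Fin n)).val ∧
        checkAll Φ n g z (fun j => y j) = true) ↔
        ∃ y : Fin N → Fin n, checkAll Φ n g z (fun j => y j) = true := by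
      refine exists_congr fun y => and_iff_right ?_
      rw [finFunctionFinEquiv_apply, finFunctionFinEquiv_apply]
      gcongr with i
      have := (y i).2
      simp only
      omega
    simp only [hall] at h2
    refine (h1.trans h2).mono ?_
    have hlt := (finFunctionFinEquiv fun _ : Fin N => (⟨n - 1, by omega⟩ : Fin n)).2
    have hle : (finFunctionFinEquiv fun _ : Fin N => (⟨n - 1, by omega⟩ : Fin n)).val ≤ n ^ N :=
      hlt.le
    simp only [timeBound, Polynomial.eval_add, Polynomial.eval_mul, Polynomial.eval_X,
      Polynomial.eval_one, Polynomial.eval_pow, Polynomial.eval_natCast, Polynomial.eval_ofNat,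
      Nat.cast_id, roundTime]
    gcongr
    exact hle.trans (Nat.pow_le_pow_left hX N)

open Computability StateTransition in
/-- The machine decides in polynomial time whether there is a placement of the marks for which
every row passes the check. -/
theorem nonempty_tm2ComputableInPolyTime {α : Type}
    (Φ : (Fin N → Bool) → (Fin N → Bool) → (Fin k → Bool) → Bool) (hN : N ≠ 0)
    (enc : α → List Bool) (f : α → Bool) (n : α → ℕ) (g z : α → ℕ → ℕ → Bool)
    (henc : ∀ x, enc x = input (n x) k (g x) (z x))
    (hf : ∀ x, f x = true ↔
      ∃ y : Fin N → Fin (n x), checkAll Φ (n x) (g x) (z x) (fun j => y j) = true) :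
    Nonempty (TM2ComputableInPolyTime enc (fun b : Bool => [b]) f) := by
  refine ⟨⟨⟨machine Φ, Equiv.refl Bool, Equiv.refl Bool⟩, timeBound N k, fun x => ?_⟩⟩
  have h := runsIn_machine (Φ := Φ) hN (n x) (g x) (z x)
  have hfx : decide (∃ y : Fin N → Fin (n x),
      checkAll Φ (n x) (g x) (z x) (fun j => y j) = true) = f x := by
    rw [Bool.eq_iff_iff, decide_eq_true_iff, hf]
  rw [← henc, hfx] at h
  have hinit : ∀ w : List Bool, initList (machine Φ) w =
      cfg (some .unary) (.init N k) w [] [] [] [] [] [] := fun w =>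
    congrArg (TM2.Cfg.mk _ _) (funext fun s => by cases s <;> rfl)
  have hhalt : ∀ w : List Bool, haltList (machine Φ) w =
      cfg none (.init N k) w [] [] [] [] [] [] := fun w =>
    congrArg (TM2.Cfg.mk _ _) (funext fun s => by cases s <;> rfl)
  refine ⟨⟨h.choose, ?_⟩, h.choose_spec.1⟩
  have hstart := (congrArg (initList (machine Φ)) (List.map_id (enc x))).trans (hinit _)
  exact (congrArg (fun y => (flip bind (TM2.step (program Φ)))^[h.choose] (some y)) hstart).trans
    (h.choose_spec.2.trans (congrArg some (hhalt [f x]).symm))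

end MarkingMachine

end DisjointConnectedSubgraphs
-- Certificates as placements of marks
namespace DisjointConnectedSubgraphs

open MarkingMachine

open Classical in
/-- The bit for the adjacency of the vertices numbered `u` and `v`. -/
noncomputable def Instance.adjBit {k : ℕ} (I : Instance k) (u v : ℕ) : Bool :=
  decide (∃ (hu : u < I.n) (hv : v < I.n), I.graph.Adj ⟨u, hu⟩ ⟨v, hv⟩)

open Classical in
/-- The bit for the membership of the vertex numbered `v` in the terminal set numbered `i`. -/
noncomputable def Instance.terminalBit {k : ℕ} (I : Instance k) (i v : ℕ) : Bool :=
  decide (∃ (hi : i < k) (hv : v < I.n), (⟨v, hv⟩ : Fin I.n) ∈ I.terminals ⟨i, hi⟩)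

open Classical in
theorem Instance.adjBit_eq {k : ℕ} (I : Instance k) (u v : Fin I.n) :
    I.adjBit u v = decide (I.graph.Adj u v) := by
  simp [Instance.adjBit]

open Classical in
theorem Instance.terminalBit_eq {k : ℕ} (I : Instance k) (i : Fin k) (v : Fin I.n) :
    I.terminalBit i v = decide (v ∈ I.terminals i) := by
  simp [Instance.terminalBit]

theorem Instance.adjBit_eq_true {k : ℕ} (I : Instance k) (u v : Fin I.n) :
    I.adjBit u v = true ↔ I.graph.Adj u v := by
  simp [Instance.adjBit_eq]

theorem Instance.terminalBit_eq_true {k : ℕ} (I : Instance k) (i : Fin k) (v : Fin I.n) :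
    I.terminalBit i v = true ↔ v ∈ I.terminals i := by
  simp [Instance.terminalBit_eq]

theorem range_map_eq_finRange_map {α : Type*} (n : ℕ) (f : ℕ → α) :
    (List.range n).map f = (List.finRange n).map fun i => f i.val := by
  rw [← List.map_coe_finRange_eq_range, List.map_map]; rfl

theorem range_flatMap_eq_finRange_flatMap {α : Type*} (n : ℕ) (f : ℕ → List α) :
    (List.range n).flatMap f = (List.finRange n).flatMap fun i => f i.val := by
  rw [List.flatMap_def, List.flatMap_def, range_map_eq_finRange_map]

theorem Instance.encode_eq_input {k : ℕ} (I : Instance k) :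
    I.encode = input I.n k I.adjBit I.terminalBit := by
  simp only [Instance.encode, input, matrix, range_flatMap_eq_finRange_flatMap,
    range_map_eq_finRange_map, List.append_assoc, List.cons_append, List.nil_append,
    Instance.adjBit_eq, Instance.terminalBit_eq]

/-- The index of the mark for the vertex number `t` of the walk number `i`. -/
def markIndex {k : ℕ} (c : ℕ) (i : Fin k) (t : ℕ) : Fin (k * (c + 1)) :=
  finProdFinEquiv (i, Fin.ofNat (c + 1) t)

/-- The condition on a vertex that carries the marks `M`, has neighbours with the marks `A` and
lies in the terminal sets `Z`. -/
structure IsGoodVertex {k : ℕ} (c : ℕ) (M A : Fin (k * (c + 1)) → Bool) (Z : Fin k → Bool) :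
    Prop where
  dom : ∀ i, Z i = true →
    ∃ t ≤ c, M (markIndex c i t) = true ∨ A (markIndex c i t) = true
  avoid : ∀ i, ∀ t ≤ c, M (markIndex c i t) = true → ∀ j, i ≠ j → ¬ Z j = true
  disj : ∀ i, ∀ t ≤ c, M (markIndex c i t) = true → ∀ j, i ≠ j → ∀ t' ≤ c,
    ¬ M (markIndex c j t') = true
  step : ∀ i, ∀ t < c, M (markIndex c i t) = true →
    M (markIndex c i (t + 1)) = true ∨ A (markIndex c i (t + 1)) = true

open Classical in
/-- The check of a vertex, as a Boolean function. -/
noncomputable def goodVertex {k : ℕ} (c : ℕ) (M A : Fin (k * (c + 1)) → Bool)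
    (Z : Fin k → Bool) : Bool := decide (IsGoodVertex c M A Z)

/-- Every clause of a certificate concerns a single vertex, its marks and terminal sets, and the
marks on its neighbours. As each mark lies on some vertex, checking all vertices checks all clauses.
-/
theorem Instance.checkAll_iff_isCertificate {k : ℕ} (I : Instance k) (c : ℕ)
    (y : Fin (k * (c + 1)) → Fin I.n) :
    checkAll (goodVertex c) I.n I.adjBit I.terminalBit (fun j => y j) = true ↔
      I.IsCertificate c fun i t => y (markIndex c i t) := by
  have hadj : ∀ (u : Fin I.n) j, ((List.range I.n).any fun w =>
      (cellAt (k := k) (fun j => (y j).val) I.terminalBit w).1 j && I.adjBit u w) = true ↔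
      I.graph.Adj u (y j) := by
    intro u j
    rw [← I.adjBit_eq_true]
    simp [cellAt]
  have hterm : ∀ (u : Fin I.n) i,
      (cellAt (fun j => (y j).val) I.terminalBit u).2 i = true ↔ u ∈ I.terminals i :=
    fun u i => I.terminalBit_eq_true i u
  have hmark : ∀ (u : Fin I.n) j,
      (cellAt (k := k) (fun j => (y j).val) I.terminalBit u).1 j = true ↔ y j = u := by
    intro u j
    simp [cellAt, Fin.ext_iff]
  have hall : checkAll (goodVertex c) I.n I.adjBit I.terminalBit (fun j => y j) = true ↔
      ∀ u : Fin I.n, IsGoodVertex c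
        (cellAt (k := k) (fun j => (y j).val) I.terminalBit u).1
        (fun j => (List.range I.n).any fun w =>
          (cellAt (k := k) (fun j => (y j).val) I.terminalBit w).1 j && I.adjBit u w)
        (cellAt (fun j => (y j).val) I.terminalBit u).2 := by
    simp only [checkAll, List.all_eq_true, List.mem_range, checkRow, goodVertex,
      decide_eq_true_iff]
    exact ⟨fun h u => h u u.2, fun h u hu => h ⟨u, hu⟩⟩
  rw [hall]
  constructor
  · intro h
    refine ⟨fun i t ht => ?_, fun i u hu => ?_, fun i t ht j hij hu => ?_,
      fun i t ht j hij t' ht' he => ?_⟩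
    · have := (h (y (markIndex c i t))).step i t ht ((hmark _ _).2 rfl)
      rw [hmark, hadj] at this
      exact this.imp Eq.symm id
    · obtain ⟨t, ht, h'⟩ := (h u).dom i ((hterm _ _).2 hu)
      rw [hmark, hadj] at h'
      exact ⟨t, ht, h'.imp Eq.symm id⟩
    · exact (h (y (markIndex c i t))).avoid i t ht ((hmark _ _).2 rfl) j hij ((hterm _ _).2 hu)
    · exact (h (y (markIndex c i t))).disj i t ht ((hmark _ _).2 rfl) j hij t' ht'
        ((hmark _ _).2 he.symm)
  · intro h u
    refine ⟨fun i hu => ?_, fun i t ht hm j hij hu => ?_, fun i t ht hm j hij t' ht' hm' => ?_,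
      fun i t ht hm => ?_⟩
    · obtain ⟨t, ht, h'⟩ := h.dom i u ((hterm _ _).1 hu)
      refine ⟨t, ht, ?_⟩
      rw [hmark, hadj]
      exact h'.imp Eq.symm id
    · rw [hmark] at hm
      subst hm
      exact h.avoid i t ht j hij ((hterm _ _).1 hu)
    · rw [hmark] at hm hm'
      exact h.disj i t ht j hij t' ht' (hm.trans hm'.symm)
    · rw [hmark] at hm
      subst hm
      rw [hmark, hadj]
      exact (h.step i t ht).imp Eq.symm id

/-- A certificate involves the walks only up to time `c`, so finitely many marks record it. -/
theorem Instance.exists_checkAll_iff {k : ℕ} (I : Instance k) (c : ℕ) :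
    (∃ y : Fin (k * (c + 1)) → Fin I.n,
      checkAll (goodVertex c) I.n I.adjBit I.terminalBit (fun j => y j) = true) ↔
    ∃ x : Fin k → ℕ → Fin I.n, I.IsCertificate c x := by
  simp only [I.checkAll_iff_isCertificate]
  constructor
  · rintro ⟨y, hy⟩
    exact ⟨_, hy⟩
  · rintro ⟨x, hx⟩
    obtain ⟨y, key⟩ : ∃ y : Fin (k * (c + 1)) → Fin I.n,
        ∀ i, ∀ t ≤ c, y (markIndex c i t) = x i t := by
      refine ⟨fun j => x (finProdFinEquiv.symm j).1 (finProdFinEquiv.symm j).2, fun i t ht => ?_⟩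
      simp only [markIndex, Equiv.symm_apply_apply, Fin.ofNat]
      -- The reduction modulo `c + 1` in `markIndex` does nothing for `t ≤ c`.
      rw [Nat.mod_eq_of_lt (by omega)]
    refine ⟨y, ?_⟩
    refine ⟨fun i t ht => ?_, fun i z hz => ?_, fun i t ht j hij => ?_,
      fun i t ht j hij t' ht' => ?_⟩
    · rw [key i t ht.le, key i (t + 1) ht]
      exact hx.step i t ht
    · obtain ⟨t, ht, h⟩ := hx.dom i z hz
      exact ⟨t, ht, by rwa [key i t ht]⟩
    · rw [key i t ht]
      exact hx.avoid i t ht j hij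
    · rw [key i t ht, key j t' ht']
      exact hx.disj i t ht j hij t' ht'

end DisjointConnectedSubgraphs

theorem mainTheorem5 {W : Type*} (H : SimpleGraph W) (s : ℕ)
    (hH : H.IsIndContained (DisjointConnectedSubgraphs.sP1P4 s)) (k : ℕ) (hk : 1 ≤ k) :
    DisjointConnectedSubgraphs.PolyTimeSolvableOn
      (DisjointConnectedSubgraphs.Instance.encode (k := k))
      {I | DisjointConnectedSubgraphs.IsFree H I.graph}
      DisjointConnectedSubgraphs.Instance.IsYes := by
  classical
  refine DisjointConnectedSubgraphs.MarkingMachine.nonempty_tm2ComputableInPolyTime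
    (DisjointConnectedSubgraphs.goodVertex (DisjointConnectedSubgraphs.walkLength s))
    -- There is at least one mark because `k ≥ 1`.
    (Nat.mul_ne_zero (by omega) (Nat.succ_ne_zero _)) _ _ (fun I => I.1.n)
    (fun I => I.1.adjBit) (fun I => I.1.terminalBit) (fun I => I.1.encode_eq_input) fun I => ?_
  rw [I.1.exists_checkAll_iff]
  refine decide_eq_true_iff.trans ?_
  exact I.1.isYes_iff_exists_isCertificate fun h => I.2 (hH.trans h)
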